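/- Let $p_1,p_2,p_3$ be distinct primes, let $n_1,n_2,n_3\ge 1$, and let $M=p_1^{n_1}p_2^{n_2}p_3^{n_3}$. For a set $A\subset\mathbb{Z}_M$ write $A(X)=\sum_{a\in A}X^a$ for its mask polynomial, with residues represented by $0,1,\dots,M-1$. Write $A\oplus B=\mathbb{Z}_M$ if every element of $\mathbb{Z}_M$ has a unique representation $a+b$ with $a\in A$, $b\in B$. Say that $A$ is $M$-fibered in the $p_i$ direction if there is a subset $A'\subset A$ such that $A$ is the disjoint union of the translates $a+F_i$, $a\in A'$, of $F_i=\{0,M/p_i,2M/p_i,\dots,(p_i-1)M/p_i\}$. Say that $A$ satisfies (T2) if, whenever $s_1,\dots,s_m$ ($m\ge 1$) are powers (with positive exponents) of distinct primes such that the cyclotomic polynomial $\Phi_{s_l}(X)$ divides $A(X)$ for every $l$, then $\Phi_{s_1\cdots s_m}(X)$ divides $A(X)$. Let $A,B\subset\mathbb{Z}_M$ with $A\oplus B=\mathbb{Z}_M$. Suppose that there is a permutation $(i,j,k)$ of $(1,2,3)$ such that $|A|=p_i\,p_j^{\alpha_j}p_k^{\alpha_k}$ for some $0\le\alpha_j\le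 n_j$, $0\le\alpha_k\le n_k$, and that $A$ is $M$-fibered in the $p_i$ direction. Then both $A$ and $B$ satisfy (T2). -/

import Mathlib

/-- The mask polynomial `A(X) = ∑_{a ∈ A} X ^ a` of a set `A` in `ZMod M` (for `M ≥ 1`), with the
residues represented by `0, …, M - 1`. For `s ∣ M`, divisibility by the `s`-th cyclotomic
polynomial does not depend on the choice of representatives, because it divides `X ^ M - 1`. -/
noncomputable def maskPoly {M : ℕ} (A : Finset (ZMod M)) : Polynomial ℤ :=
  ∑ a ∈ A, Polynomial.X ^ a.val

/-- `A ⊕ B = ℤ_M`: every element of `ZMod M` is `a + b` for exactly one pair `(a, b)` in `A × B`. -/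
def IsTiling {M : ℕ} (A B : Finset (ZMod M)) : Prop :=
  AddSubgroup.IsComplement (A : Set (ZMod M)) (B : Set (ZMod M))

/-- The fiber `{0, M/p, 2M/p, …, (p-1)M/p}` in the `p` direction, through `0`. -/
def fiber (M p : ℕ) : Finset (ZMod M) :=
  (Finset.range p).image fun ν => ((ν * (M / p) : ℕ) : ZMod M)

/-- The weight at `x` of the convolution `A * B` of two sets: the number of pairs `(a, b)` in
`A × B` with `a + b = x`. -/
def convWeight {M : ℕ} (A B : Finset (ZMod M)) (x : ZMod M) : ℕ :=
  ((A ×ˢ B).filter fun y => y.1 + y.2 = x).card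

/-- `A` is `M`-fibered in the `p` direction: there is a subset `A'` of `A` with `A = A' * F`, where
`F` is the fiber through `0` and the product is the convolution, so that `A` is the disjoint union
of the translates `a + F` with `a ∈ A'`. -/
def IsFibered {M : ℕ} (A : Finset (ZMod M)) (p : ℕ) : Prop :=
  ∃ A' : Finset (ZMod M), A' ⊆ A ∧
    ∀ x : ZMod M, convWeight A' (fiber M p) x = if x ∈ A then 1 else 0

/-- Condition (T2) for an integer polynomial `P`: if `s_p = p ^ e_p` with `e_p ≥ 1`, where `p` runs
over a non-empty finite set of primes, and every cyclotomic polynomial `Φ_{s_p}` divides `P`, then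
`Φ_s` with `s = ∏ s_p` divides `P`. -/
def PolyT2 (P : Polynomial ℤ) : Prop :=
  ∀ (J : Finset ℕ) (e : ℕ → ℕ), J.Nonempty →
    (∀ p ∈ J, p.Prime ∧ 1 ≤ e p ∧ Polynomial.cyclotomic (p ^ e p) ℤ ∣ P) →
    Polynomial.cyclotomic (∏ p ∈ J, p ^ e p) ℤ ∣ P

/-- Condition (T2) for a set in `ZMod M`. -/
def SatisfiesT2 {M : ℕ} (A : Finset (ZMod M)) : Prop :=
  PolyT2 (maskPoly A)

/-! Write $M=p^nN$ with $p=p_i\nmid N$, and $A=A'\oplus F$ with $F$ the fiber of step $d=M/p$. As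
$|A|$ has exactly one factor $p$, $p\nmid|A'|$. Moving the fiber across gives a tiling $A'\oplus
C=\mathbb{Z}_M$ with $C=B\oplus F$. Tijdeman's theorem allows $A'$ to be dilated by $p^n$; the
dilate lies in one class modulo $p^n$, so $A'$ tiles $\mathbb{Z}_N$ with every rescaled class $C_i$
of $C$ modulo $p^n$. Since $N$ has only two prime factors, (T2) is known there: by Sands' theorem
one tile lies in a single class modulo a prime, and induction on the order applies.

Returning to $M$ uses that, at a root of unity of order $s\mid M$, $F$ takes the value $p$ if $s\mid
d$ and $0$ otherwise. For $A$: a divisor $\Phi_{p^e}$ must have $e=n$, and then $F$ supplies every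
required zero; without $p$ among the primes, the question descends to $A'$ in $\mathbb{Z}_N$. For
$B$: the exponent of $p$ is below $n$, so $F$ does not vanish, and $B(z)=0$ follows from
$C(z)=\sum_i z^iC_i(z^{p^n})=0$. -/

open Polynomial

/-! ### Mask polynomials, tilings and their cyclotomic divisors -/

/-- The mask polynomial of a finite set of natural numbers. -/
noncomputable def natMask (A : Finset ℕ) : ℤ[X] := ∑ a ∈ A, X ^ a

/-- The value of the mask polynomial of a finite set of natural numbers at a complex number. -/
noncomputable def rootSum (A : Finset ℕ) (z : ℂ) : ℂ := ∑ a ∈ A, z ^ a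

/-- The `s`-th cyclotomic polynomial divides the mask polynomial of `A`. -/
def CycDvd (A : Finset ℕ) (s : ℕ) : Prop := cyclotomic s ℤ ∣ natMask A

/-- Two finite sets of natural numbers tile `ℤ / M` by sums: every residue is covered, and there are
at most `M` pairs. -/
def TilesMod (M : ℕ) (A B : Finset ℕ) : Prop :=
  A.card * B.card ≤ M ∧ ∀ x : ℕ, ∃ a ∈ A, ∃ b ∈ B, a + b ≡ x [MOD M]

theorem natMask_eval_one (A : Finset ℕ) : (natMask A).eval 1 = A.card := by
  simp [natMask, eval_finsetSum]

theorem aeval_natMask (A : Finset ℕ) (z : ℂ) : aeval z (natMask A) = rootSum A z := by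
  simp [natMask, rootSum]

theorem cyclotomic_dvd_iff_aeval {s : ℕ} (hs : 0 < s) {z : ℂ} (hz : IsPrimitiveRoot z s)
    (P : ℤ[X]) : cyclotomic s ℤ ∣ P ↔ aeval z P = 0 := by
  rw [cyclotomic_eq_minpoly hz hs]
  exact (minpoly.isIntegrallyClosed_dvd_iff (hz.isIntegral hs) P).symm

theorem cycDvd_iff {A : Finset ℕ} {s : ℕ} (hs : 0 < s) {z : ℂ} (hz : IsPrimitiveRoot z s) :
    CycDvd A s ↔ rootSum A z = 0 := by
  rw [CycDvd, cyclotomic_dvd_iff_aeval hs hz, aeval_natMask]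

theorem exists_primitiveRoot {s : ℕ} (hs : 0 < s) : ∃ z : ℂ, IsPrimitiveRoot z s :=
  ⟨_, Complex.isPrimitiveRoot_exp s hs.ne'⟩

theorem CycDvd.prime_dvd_card {A : Finset ℕ} {q e : ℕ} (hq : q.Prime) (he : 1 ≤ e)
    (h : CycDvd A (q ^ e)) : q ∣ A.card := by
  have := Fact.mk hq
  obtain ⟨k, rfl⟩ := Nat.exists_eq_add_of_le' he
  have := eval_dvd (x := 1) h
  rw [natMask_eval_one, eval_one_cyclotomic_prime_pow] at this
  exact_mod_cast this

namespace TilesMod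

variable {M : ℕ} {A B : Finset ℕ}

theorem symm (h : TilesMod M A B) : TilesMod M B A := by
  refine ⟨by rw [mul_comm]; exact h.1, fun x => ?_⟩
  obtain ⟨a, ha, b, hb, hab⟩ := h.2 x
  exact ⟨b, hb, a, ha, by rwa [add_comm]⟩

theorem range_subset (h : TilesMod M A B) :
    Finset.range M ⊆ (A ×ˢ B).image fun y => (y.1 + y.2) % M := by
  intro x hx
  obtain ⟨a, ha, b, hb, hab⟩ := h.2 x
  refine Finset.mem_image.2 ⟨(a, b), Finset.mem_product.2 ⟨ha, hb⟩, ?_⟩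
  exact Nat.mod_eq_of_modEq hab (Finset.mem_range.1 hx)

theorem card_mul (h : TilesMod M A B) : A.card * B.card = M := by
  refine le_antisymm h.1 ?_
  have h1 := Finset.card_le_card h.range_subset
  rw [Finset.card_range] at h1
  exact h1.trans (Finset.card_image_le.trans (Finset.card_product A B).le)

theorem injOn (h : TilesMod M A B) :
    Set.InjOn (fun y : ℕ × ℕ => (y.1 + y.2) % M) (A ×ˢ B : Finset (ℕ × ℕ)) := by
  rw [← Finset.card_image_iff]
  refine le_antisymm Finset.card_image_le ?_
  have h1 := Finset.card_le_card h.range_subset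
  rw [Finset.card_product, h.card_mul]
  rwa [Finset.card_range] at h1

theorem inj (h : TilesMod M A B) {a a' b b' : ℕ} (ha : a ∈ A) (ha' : a' ∈ A) (hb : b ∈ B)
    (hb' : b' ∈ B) (hab : a + b ≡ a' + b' [MOD M]) : a = a' ∧ b = b' := by
  have := h.injOn (x₁ := (a, b)) (x₂ := (a', b')) (by simp [ha, hb]) (by simp [ha', hb'])
    hab
  simpa using this

theorem image_eq (hM : 0 < M) (h : TilesMod M A B) :
    ((A ×ˢ B).image fun y => (y.1 + y.2) % M) = Finset.range M := by
  refine Finset.Subset.antisymm ?_ h.range_subset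
  intro x hx
  obtain ⟨y, -, rfl⟩ := Finset.mem_image.1 hx
  exact Finset.mem_range.2 (Nat.mod_lt _ hM)

/-- Reducing exponents modulo $M$ changes the product only by a multiple of $X^M-1$, and the reduced
exponents run once through $0,\dots,M-1$. -/
theorem geom_sum_dvd (hM : 0 < M) (h : TilesMod M A B) :
    (∑ x ∈ Finset.range M, (X : ℤ[X]) ^ x) ∣ natMask A * natMask B := by
  have hX : (∑ x ∈ Finset.range M, (X : ℤ[X]) ^ x) ∣ X ^ M - 1 := ⟨X - 1, (geom_sum_mul _ _).symm⟩
  have h1 : ∑ x ∈ Finset.range M, (X : ℤ[X]) ^ x = ∑ y ∈ A ×ˢ B, X ^ ((y.1 + y.2) % M) := by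
    rw [← h.image_eq hM, Finset.sum_image h.injOn]
  have h2 : natMask A * natMask B = ∑ y ∈ A ×ˢ B, X ^ (y.1 + y.2) := by
    rw [natMask, natMask, Finset.sum_mul_sum, Finset.sum_product]
    simp only [pow_add]
  have h3 : (X : ℤ[X]) ^ M - 1 ∣ natMask A * natMask B - ∑ x ∈ Finset.range M, X ^ x := by
    rw [h1, h2, ← Finset.sum_sub_distrib]
    refine Finset.dvd_sum fun y _ => ?_
    set m := y.1 + y.2
    have : (X : ℤ[X]) ^ m - X ^ (m % M) = X ^ (m % M) * ((X ^ M) ^ (m / M) - 1) := by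
      rw [mul_sub, ← pow_mul, ← pow_add, Nat.mod_add_div, mul_one]
    rw [this]
    refine Dvd.dvd.mul_left ?_ _
    simpa using sub_dvd_pow_sub_pow ((X : ℤ[X]) ^ M) 1 (m / M)
  exact (dvd_sub_self_right).1 (hX.trans h3)

theorem cycDvd_or (hM : 0 < M) (h : TilesMod M A B) {s : ℕ} (hs : s ∣ M) (hs1 : s ≠ 1) :
    CycDvd A s ∨ CycDvd B s := by
  have hs0 : 0 < s := Nat.pos_of_dvd_of_pos hs hM
  have hp : Prime (cyclotomic s ℤ) := (cyclotomic.irreducible hs0).prime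
  refine hp.dvd_or_dvd (Dvd.dvd.trans ?_ (h.geom_sum_dvd hM))
  rw [← prod_cyclotomic_eq_geom_sum hM]
  exact Finset.dvd_prod_of_mem _ (by simp [hs, hs1, hM.ne'])

/-- The value at $1$ matters because $\Phi_{q^e}(1)=q$: no prime-power cyclotomic factor can hide in
the quotient. -/
theorem exists_quotient (hM : 0 < M) (h : TilesMod M A B) :
    ∃ Q : ℤ[X], natMask A * natMask B = (∑ x ∈ Finset.range M, X ^ x) * Q ∧ Q.eval 1 = 1 := by
  obtain ⟨Q, hQ⟩ := h.geom_sum_dvd hM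
  refine ⟨Q, hQ, ?_⟩
  have := congrArg (eval 1) hQ
  rw [eval_mul, natMask_eval_one, natMask_eval_one, eval_mul, ← Nat.cast_mul, h.card_mul] at this
  simp only [eval_finsetSum, eval_pow, eval_X, one_pow, Finset.sum_const, Finset.card_range,
    nsmul_eq_mul, mul_one] at this
  have hM' : (M : ℤ) ≠ 0 := by exact_mod_cast hM.ne'
  exact (mul_left_cancel₀ hM' (by linarith))

end TilesMod

theorem not_cyclotomic_prime_pow_dvd {q e : ℕ} (hq : q.Prime) (he : 1 ≤ e) {Q : ℤ[X]}
    (hQ : Q.eval 1 = 1) : ¬ cyclotomic (q ^ e) ℤ ∣ Q := by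
  intro h
  have := Fact.mk hq
  obtain ⟨k, rfl⟩ := Nat.exists_eq_add_of_le' he
  have := eval_dvd (x := 1) h
  rw [hQ, eval_one_cyclotomic_prime_pow] at this
  have h1 : q ∣ 1 := by exact_mod_cast this
  exact hq.one_lt.ne' (Nat.dvd_one.1 h1)

namespace TilesMod

variable {M : ℕ} {A B : Finset ℕ}

theorem dvd_of_cycDvd (hM : 0 < M) (h : TilesMod M A B) {q e : ℕ} (hq : q.Prime) (he : 1 ≤ e)
    (hA : CycDvd A (q ^ e)) : q ^ e ∣ M := by
  obtain ⟨Q, hQ, hQ1⟩ := h.exists_quotient hM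
  have hs0 : 0 < q ^ e := pow_pos hq.pos e
  have hp : Prime (cyclotomic (q ^ e) ℤ) := (cyclotomic.irreducible hs0).prime
  have h1 : cyclotomic (q ^ e) ℤ ∣ (∑ x ∈ Finset.range M, X ^ x) * Q := hQ ▸ hA.mul_right _
  have h2 := (hp.dvd_or_dvd h1).resolve_right (not_cyclotomic_prime_pow_dvd hq he hQ1)
  obtain ⟨z, hz⟩ := exists_primitiveRoot hs0
  rw [cyclotomic_dvd_iff_aeval hs0 hz] at h2
  refine hz.dvd_of_pow_eq_one M ?_
  have h3 := geom_sum_mul z M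
  simp only [map_sum, map_pow, aeval_X] at h2
  rw [h2, zero_mul] at h3
  exact (sub_eq_zero.1 h3.symm)

/-- Otherwise $\Phi_{q^e}^2$ would divide $X^M-1$, whose derivative has no zero at a root of unity.
-/
theorem not_both (hM : 0 < M) (h : TilesMod M A B) {q e : ℕ} (hq : q.Prime) (he : 1 ≤ e)
    (hA : CycDvd A (q ^ e)) (hB : CycDvd B (q ^ e)) : False := by
  have hdvd := h.dvd_of_cycDvd hM hq he hA
  obtain ⟨Q, hQ, hQ1⟩ := h.exists_quotient hM
  have hs0 : 0 < q ^ e := pow_pos hq.pos e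
  have hp : Prime (cyclotomic (q ^ e) ℤ) := (cyclotomic.irreducible hs0).prime
  have hT : cyclotomic (q ^ e) ℤ ∣ ∑ x ∈ Finset.range M, X ^ x := by
    rw [← prod_cyclotomic_eq_geom_sum hM]
    refine Finset.dvd_prod_of_mem _ ?_
    simp [hdvd, hM.ne', hq.one_lt.ne', Nat.one_le_iff_ne_zero.1 he]
  obtain ⟨T, hT⟩ := hT
  have h1 : cyclotomic (q ^ e) ℤ * cyclotomic (q ^ e) ℤ ∣ cyclotomic (q ^ e) ℤ * (T * Q) := by
    rw [← mul_assoc, ← hT, ← hQ]; exact mul_dvd_mul hA hB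
  have h2 := (mul_dvd_mul_iff_left hp.ne_zero).1 h1
  have h3 := (hp.dvd_or_dvd h2).resolve_right (not_cyclotomic_prime_pow_dvd hq he hQ1)
  obtain ⟨S, hS⟩ := h3
  have h4 : (X : ℤ[X]) ^ M - 1 =
      cyclotomic (q ^ e) ℤ * cyclotomic (q ^ e) ℤ * (S * (X - 1)) := by
    rw [← geom_sum_mul, hT, hS]; ring
  obtain ⟨z, hz⟩ := exists_primitiveRoot hs0
  have h0 := (cyclotomic_dvd_iff_aeval hs0 hz _).1 dvd_rfl
  have h5 := congrArg (fun P => aeval z (derivative P)) h4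
  simp only [derivative_sub, derivative_X_pow, derivative_one, sub_zero, derivative_mul, map_mul,
    map_add, h0] at h5
  have hz0 : z ≠ 0 := hz.ne_zero hs0.ne'
  simp [hM.ne', hz0] at h5

end TilesMod

/-! ### Tijdeman's dilation theorem -/

namespace TilesMod

variable {M : ℕ} {A B : Finset ℕ}

/-- Tijdeman's theorem for a prime dilation factor. -/
theorem dilate_prime (hM : 0 < M) (h : TilesMod M A B) {q : ℕ} (hq : q.Prime)
    (hA : ¬ q ∣ A.card) : TilesMod M (A.image (q * ·)) B := by
  have := Fact.mk hq
  have : NeZero M := ⟨hM.ne'⟩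
  refine ⟨(Nat.mul_le_mul_right _ Finset.card_image_le).trans h.1, fun x => ?_⟩
  -- In the group algebra over $\mathbb{F}_q$ the tiling reads $\alpha\beta=\tau$, and Frobenius
  -- turns $\alpha$ into the element of the dilate $qA$.
  let e : ZMod M → AddMonoidAlgebra (ZMod q) (ZMod M) := fun g => AddMonoidAlgebra.single g 1
  have he : ∀ g g', e g * e g' = e (g + g') := fun g g' => by
    simp [e, AddMonoidAlgebra.single_mul_single]
  set α := ∑ a ∈ A, e (a : ZMod M) with hα
  set β := ∑ b ∈ B, e (b : ZMod M) with hβ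
  set τ := ∑ g : ZMod M, e g with hτ
  have hmul : α * β = τ := by
    rw [hα, hβ, Finset.sum_mul_sum, ← Finset.sum_product']
    refine Finset.sum_bij (fun y _ => ((y.1 + y.2 : ℕ) : ZMod M)) (fun _ _ => Finset.mem_univ _)
      ?_ ?_ ?_
    · intro y hy y' hy' hyy
      refine h.injOn (by exact_mod_cast hy) (by exact_mod_cast hy') ?_
      exact (ZMod.natCast_eq_natCast_iff _ _ _).1 hyy
    · intro g _
      obtain ⟨a, ha, b, hb, hab⟩ := h.2 g.val
      refine ⟨(a, b), Finset.mem_product.2 ⟨ha, hb⟩, ?_⟩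
      rw [(ZMod.natCast_eq_natCast_iff _ _ _).2 hab, ZMod.natCast_zmod_val]
    · intro y _
      rw [he]; push_cast; rfl
  have hshift : ∀ g, e g * τ = τ := fun g => by
    rw [hτ, Finset.mul_sum]
    simp only [he]
    exact Fintype.sum_equiv (Equiv.addLeft g) _ _ fun _ => rfl
  have hατ : α * τ = (A.card : AddMonoidAlgebra (ZMod q) (ZMod M)) * τ := by
    rw [hα, Finset.sum_mul]
    simp [hshift]
  have hατ' : ∀ k : ℕ, α ^ k * τ = (A.card : AddMonoidAlgebra (ZMod q) (ZMod M)) ^ k * τ := by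
    intro k
    induction k with
    | zero => simp
    | succ k ih => rw [pow_succ, mul_assoc, hατ, mul_left_comm, ih, pow_succ]; ring
  have : CharP (AddMonoidAlgebra (ZMod q) (ZMod M)) q :=
    charP_of_injective_algebraMap (algebraMap (ZMod q) _).injective q
  have hpow : α ^ q = ∑ a ∈ A, e ((q * a : ℕ) : ZMod M) := by
    rw [hα, sum_pow_char q]
    refine Finset.sum_congr rfl fun a _ => ?_
    simp [e, AddMonoidAlgebra.single_pow]
  -- Fermat's little theorem; this is where $q\nmid|A|$ enters. It gives
  -- $\alpha^q\beta=\alpha^{q-1}\tau=|A|^{q-1}\tau=\tau$.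
  have hcard : (A.card : AddMonoidAlgebra (ZMod q) (ZMod M)) ^ (q - 1) = 1 := by
    have h1 : ((A.card : ZMod q)) ^ (q - 1) = 1 :=
      ZMod.pow_card_sub_one_eq_one (by rwa [Ne, ZMod.natCast_eq_zero_iff])
    have h2 := congrArg (algebraMap (ZMod q) (AddMonoidAlgebra (ZMod q) (ZMod M))) h1
    rwa [map_pow, map_natCast, map_one] at h2
  have key : ∑ y ∈ A ×ˢ B, e ((q * y.1 + y.2 : ℕ) : ZMod M) = τ := by
    have h1 : α ^ q * β = τ := by
      rw [← pow_sub_one_mul hq.ne_zero α, mul_assoc, hmul, hατ', hcard, one_mul]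
    rw [← h1, hpow, hβ, Finset.sum_mul_sum, ← Finset.sum_product']
    refine Finset.sum_congr rfl fun y _ => ?_
    rw [he]; push_cast; rfl
  -- Coefficients are known only modulo $q$, but a nonzero one already shows that $x$ is covered;
  -- the bound on the number of pairs does the rest.
  by_contra hx
  push Not at hx
  have h1 := congrArg (fun f : AddMonoidAlgebra (ZMod q) (ZMod M) => f.coeff (x : ZMod M)) key
  simp only [hτ, e, AddMonoidAlgebra.coeff_sum, AddMonoidAlgebra.coeff_single,
    Finsupp.finsetSum_apply, Finsupp.single_apply] at h1
  rw [Finset.sum_eq_zero] at h1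
  · simp at h1
  · intro y hy
    rw [if_neg]
    intro hyx
    obtain ⟨hy1, hy2⟩ := Finset.mem_product.1 hy
    exact hx _ (Finset.mem_image_of_mem _ hy1) _ hy2 ((ZMod.natCast_eq_natCast_iff _ _ _).1 hyx)

/-- Tijdeman's theorem: a tile may be dilated by any factor coprime to its cardinality. -/
theorem dilate (hM : 0 < M) {r : ℕ} (hr : 0 < r) :
    ∀ {A : Finset ℕ}, TilesMod M A B → r.Coprime A.card → TilesMod M (A.image (r * ·)) B := by
  induction r using Nat.recOnMul with
  | zero => exact absurd hr (lt_irrefl _)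
  | one => intro A h _; simpa using h
  | prime q hq =>
    intro A h hc
    exact h.dilate_prime hM hq ((Nat.Prime.coprime_iff_not_dvd hq).1 hc)
  | mul a b iha ihb =>
    intro A h hc
    have hb : 0 < b := Nat.pos_of_mul_pos_left hr
    have ha : 0 < a := Nat.pos_of_mul_pos_right hr
    have hinj : (A.image (b * ·)).card = A.card :=
      Finset.card_image_of_injective _ (mul_right_injective₀ hb.ne')
    have := iha ha (ihb hb h hc.coprime_mul_left) (by rw [hinj]; exact hc.coprime_mul_right)
    rw [Finset.image_image] at this
    simpa [Function.comp_def, mul_assoc] using this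

end TilesMod

/-! ### Splitting a tiling into residue classes -/

/-- The elements of `B` in the class of `i` modulo `r`, rescaled by `1 / r`. -/
def residueClass (r i : ℕ) (B : Finset ℕ) : Finset ℕ :=
  (B.filter fun b => b % r = i).image (· / r)

theorem div_injOn_filter (r i : ℕ) (B : Finset ℕ) :
    Set.InjOn (· / r) (B.filter fun b => b % r = i : Finset ℕ) := by
  intro b hb b' hb' h
  simp only [Finset.coe_filter, Set.mem_ofPred_eq] at hb hb'
  have h' : b / r = b' / r := h
  rw [← Nat.mod_add_div b r, ← Nat.mod_add_div b' r, hb.2, hb'.2, h']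

theorem card_eq_sum_residueClass {r : ℕ} (hr : 0 < r) (B : Finset ℕ) :
    B.card = ∑ i ∈ Finset.range r, (residueClass r i B).card := by
  rw [Finset.card_eq_sum_card_fiberwise (f := (· % r)) (t := Finset.range r)
    (fun b _ => by simpa using Nat.mod_lt b hr)]
  exact Finset.sum_congr rfl fun i _ => (Finset.card_image_of_injOn (div_injOn_filter r i B)).symm

theorem rootSum_eq_sum_residueClass {r : ℕ} (hr : 0 < r) (B : Finset ℕ) (z : ℂ) :
    rootSum B z = ∑ i ∈ Finset.range r, z ^ i * rootSum (residueClass r i B) (z ^ r) := by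
  rw [rootSum, ← Finset.sum_fiberwise_of_maps_to (g := (· % r)) (t := Finset.range r)
    (fun b _ => by simpa using Nat.mod_lt b hr)]
  refine Finset.sum_congr rfl fun i _ => ?_
  rw [rootSum, residueClass, Finset.sum_image (div_injOn_filter r i B), Finset.mul_sum]
  refine Finset.sum_congr rfl fun b hb => ?_
  rw [← pow_mul, ← pow_add, ← (Finset.mem_filter.1 hb).2, Nat.mod_add_div]

theorem rootSum_image_mul_add {r : ℕ} (hr : 0 < r) (c : ℕ) (A : Finset ℕ) (z : ℂ) :
    rootSum (A.image (r * · + c)) z = z ^ c * rootSum A (z ^ r) := by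
  rw [rootSum, Finset.sum_image, rootSum, Finset.mul_sum]
  · exact Finset.sum_congr rfl fun a _ => by rw [← pow_mul, ← pow_add, add_comm]
  · intro a _ a' _ h
    have h' : r * a + c = r * a' + c := h
    exact Nat.eq_of_mul_eq_mul_left hr (by omega)

theorem eq_image_of_mod_eq {r c : ℕ} {A : Finset ℕ} (h : ∀ a ∈ A, a % r = c) :
    A = (A.image (· / r)).image (r * · + c) := by
  rw [Finset.image_image]
  conv_lhs => rw [← Finset.image_id (s := A)]
  refine Finset.image_congr fun a ha => ?_
  have := Nat.div_add_mod a r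
  rw [h a ha] at this
  exact this.symm

/-- A tile inside one residue class modulo `r` tiles each residue class of the complement. -/
theorem TilesMod.tilesMod_residueClass {r N c : ℕ} (hr : 0 < r) {A B : Finset ℕ}
    (h : TilesMod (r * N) (A.image (r * · + c)) B) {i : ℕ} (hi : i < r) :
    TilesMod N A (residueClass r i B) := by
  have hcov : ∀ i < r, ∀ x : ℕ, ∃ a ∈ A, ∃ b ∈ residueClass r i B, a + b ≡ x [MOD N] := by
    intro i hi x
    obtain ⟨a₀, ha₀, b, hb, hab⟩ := h.2 (r * x + i + c)
    obtain ⟨a, ha, rfl⟩ := Finset.mem_image.1 ha₀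
    have h1 : r * a + b ≡ r * x + i [MOD r * N] :=
      Nat.ModEq.add_right_cancel' c (by convert hab using 1; ring)
    have h2 : b % r = i := by
      have := h1.of_mul_right N
      unfold Nat.ModEq at this
      rwa [Nat.mul_add_mod, Nat.mul_add_mod, Nat.mod_eq_of_lt hi] at this
    refine ⟨a, ha, b / r, Finset.mem_image_of_mem _ (Finset.mem_filter.2 ⟨hb, h2⟩), ?_⟩
    have h3 := Nat.mod_add_div b r
    rw [h2] at h3
    rw [← h3] at h1
    have h4 : r * (a + b / r) ≡ r * x [MOD r * N] :=
      Nat.ModEq.add_right_cancel' i (by convert h1 using 1; ring)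
    exact Nat.ModEq.mul_left_cancel' hr.ne' h4
  have hle : ∀ i < r, N ≤ A.card * (residueClass r i B).card := by
    intro i hi
    have h1 : Finset.range N ⊆
        (A ×ˢ residueClass r i B).image fun y => (y.1 + y.2) % N := by
      intro x hx
      obtain ⟨a, ha, b, hb, hab⟩ := hcov i hi x
      exact Finset.mem_image.2 ⟨(a, b), Finset.mem_product.2 ⟨ha, hb⟩,
        Nat.mod_eq_of_modEq hab (Finset.mem_range.1 hx)⟩
    have h2 := (Finset.card_le_card h1).trans Finset.card_image_le
    rwa [Finset.card_range, Finset.card_product] at h2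
  refine ⟨?_, hcov i hi⟩
  -- Each class needs at least $N$ pairs and all $r$ classes together have at most $rN$, so none can
  -- exceed $N$.
  by_contra! hlt
  have hcard : (A.image (r * · + c)).card = A.card :=
    Finset.card_image_of_injective _ fun a a' h =>
      Nat.eq_of_mul_eq_mul_left hr (Nat.add_right_cancel h)
  have h1 := h.1
  rw [hcard, card_eq_sum_residueClass hr B, Finset.mul_sum] at h1
  have h2 : ∑ i ∈ Finset.range r, N <
      ∑ i ∈ Finset.range r, A.card * (residueClass r i B).card :=
    Finset.sum_lt_sum (fun i hi => hle i (Finset.mem_range.1 hi))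
      ⟨i, Finset.mem_range.2 hi, hlt⟩
  rw [Finset.sum_const, Finset.card_range, smul_eq_mul] at h2
  omega

theorem CycDvd.of_primitiveRoot {A A' : Finset ℕ} {s s' : ℕ} (hs : 0 < s) (hs' : 0 < s')
    {z z' : ℂ} (hz : IsPrimitiveRoot z s) (hz' : IsPrimitiveRoot z' s') (h : CycDvd A s)
    (hA : rootSum A z = 0 → rootSum A' z' = 0) : CycDvd A' s' :=
  (cycDvd_iff hs' hz').2 (hA ((cycDvd_iff hs hz).1 h))

/-! ### Sands' theorem -/

/-- A set meeting at least two classes modulo each of `p` and `q` has two elements that are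
incongruent both modulo `p` and modulo `q`. -/
theorem exists_incongruent {p q : ℕ} {A : Finset ℕ} (hp : ∀ c, ∃ a ∈ A, a % p ≠ c)
    (hq : ∀ c, ∃ a ∈ A, a % q ≠ c) : ∃ a ∈ A, ∃ a' ∈ A, a % p ≠ a' % p ∧ a % q ≠ a' % q := by
  obtain ⟨a₀, h₀, -⟩ := hp 0
  obtain ⟨a₁, h₁, h₁'⟩ := hp (a₀ % p)
  by_cases h : a₁ % q = a₀ % q
  · obtain ⟨a₂, h₂, h₂'⟩ := hq (a₀ % q)
    by_cases h3 : a₂ % p = a₀ % p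
    · exact ⟨a₂, h₂, a₁, h₁, by rw [h3]; exact h₁'.symm, by rwa [h]⟩
    · exact ⟨a₂, h₂, a₀, h₀, h3, h₂'⟩
  · exact ⟨a₁, h₁, a₀, h₀, h₁', h⟩

theorem isUnit_sub_of_incongruent {p q M a a' : ℕ}
    (hM' : ∀ l : ℕ, l.Prime → l ∣ M → l = p ∨ l = q) (h1 : a % p ≠ a' % p) (h2 : a % q ≠ a' % q) :
    IsUnit ((a : ZMod M) - a') := by
  have key : IsCoprime ((a : ℤ) - a') M := by
    rw [Int.isCoprime_iff_gcd_eq_one]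
    by_contra hne
    obtain ⟨l, hl, hld⟩ := Nat.exists_prime_and_dvd hne
    have hd := (Int.natCast_dvd_natCast.2 hld).trans (Int.gcd_dvd_left _ _)
    have hlM := Int.natCast_dvd_natCast.1 ((Int.natCast_dvd_natCast.2 hld).trans (Int.gcd_dvd_right _ _))
    have hmod : a % l = a' % l := ((Nat.modEq_iff_dvd).2 hd).symm
    rcases hM' l hl hlM with rfl | rfl
    · exact h1 hmod
    · exact h2 hmod
  have := (ZMod.coe_int_isUnit_iff_isCoprime ((a : ℤ) - a') M).2 key.symm
  simpa using this

/-- Sands' theorem: in a tiling of a cyclic group whose order has at most two prime factors `p` and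
`q`, one of the tiles lies in a single residue class modulo `p` or modulo `q`. -/
theorem TilesMod.exists_mod_eq {p q M : ℕ} (hp : p.Prime) (hpM : p ∣ M) (hM : 0 < M)
    (hM' : ∀ l : ℕ, l.Prime → l ∣ M → l = p ∨ l = q) {A B : Finset ℕ} (h : TilesMod M A B) :
    (∃ c, ∀ a ∈ A, a % p = c) ∨ (∃ c, ∀ a ∈ A, a % q = c) ∨
      (∃ c, ∀ b ∈ B, b % p = c) ∨ (∃ c, ∀ b ∈ B, b % q = c) := by
  by_contra! hcon
  obtain ⟨a, ha, a', ha', hap, haq⟩ := exists_incongruent hcon.1 hcon.2.1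
  obtain ⟨b, hb, b', hb', hbp, hbq⟩ := exists_incongruent hcon.2.2.1 hcon.2.2.2
  have hM1 : 1 < M := hp.one_lt.trans_le (Nat.le_of_dvd hM hpM)
  have : NeZero M := ⟨hM.ne'⟩
  have : Fact (1 < M) := ⟨hM1⟩
  obtain ⟨u, hu⟩ := isUnit_sub_of_incongruent hM' hap haq
  obtain ⟨v, hv⟩ := isUnit_sub_of_incongruent hM' hbp hbq
  -- The dilation factor is chosen so that $r(a-a')=b-b'$; then $ra+b'=ra'+b$ is a collision in the
  -- dilated tiling.
  set r := ((v * u⁻¹ : (ZMod M)ˣ) : ZMod M).val with hr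
  have hrM : r.Coprime M := ZMod.val_coe_unit_coprime _
  have hr0 : 0 < r := by
    rcases Nat.eq_zero_or_pos r with h0 | h0
    · rw [h0, Nat.coprime_zero_left] at hrM; omega
    · exact h0
  have hrA : r.Coprime A.card := hrM.coprime_dvd_right ⟨_, h.card_mul.symm⟩
  have hd := h.dilate hM hr0 hrA
  have heq : (r : ZMod M) * ((a : ZMod M) - a') = b - b' := by
    rw [hr, ZMod.natCast_zmod_val, ← hu, ← hv, ← Units.val_mul, inv_mul_cancel_right]
  have hmod : r * a + b' ≡ r * a' + b [MOD M] := by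
    rw [← ZMod.natCast_eq_natCast_iff]
    push_cast
    linear_combination heq
  have := (hd.inj (Finset.mem_image_of_mem _ ha) (Finset.mem_image_of_mem _ ha') hb' hb hmod).2
  exact hbp (by rw [this])

/-! ### (T2) for two primes -/

/-- The case of the two-prime theorem in which `A` lies in one class modulo `p`. -/
theorem TilesMod.cycDvd_mul_of_left {p q N c α β : ℕ} (hp : p.Prime) (hq : q.Prime) (hpq : p ≠ q)
    {A₀ B : Finset ℕ} (hN : 0 < N)
    (ih : ∀ {A B : Finset ℕ} {α β : ℕ}, 1 ≤ α → 1 ≤ β → TilesMod N A B → CycDvd A (p ^ α) →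
      CycDvd A (q ^ β) → CycDvd A (p ^ α * q ^ β))
    (hα : 1 ≤ α) (hβ : 1 ≤ β) (h : TilesMod (p * N) (A₀.image (p * · + c)) B)
    (h1 : CycDvd (A₀.image (p * · + c)) (p ^ α)) (h2 : CycDvd (A₀.image (p * · + c)) (q ^ β)) :
    CycDvd (A₀.image (p * · + c)) (p ^ α * q ^ β) := by
  have h0 := h.tilesMod_residueClass hp.pos (i := 0) hp.pos
  obtain ⟨α, rfl⟩ := Nat.exists_eq_add_of_le' hα
  have hpa := pow_pos hp.pos α
  have hqb := pow_pos hq.pos β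
  have hzero : ∀ z : ℂ, z ≠ 0 → rootSum (A₀.image (p * · + c)) z = 0 → rootSum A₀ (z ^ p) = 0 := by
    intro z hz hz0
    rw [rootSum_image_mul_add hp.pos] at hz0
    exact (mul_eq_zero.1 hz0).resolve_left (pow_ne_zero _ hz)
  have h1' : CycDvd A₀ (p ^ α) := by
    obtain ⟨z, hz⟩ := exists_primitiveRoot (pow_pos hp.pos (α + 1))
    exact h1.of_primitiveRoot (pow_pos hp.pos _) hpa hz
      (hz.pow (pow_pos hp.pos _) (by rw [pow_succ'])) (hzero z (hz.ne_zero (pow_pos hp.pos _).ne'))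
  have h2' : CycDvd A₀ (q ^ β) := by
    obtain ⟨z, hz⟩ := exists_primitiveRoot hqb
    exact h2.of_primitiveRoot hqb hqb hz
      (hz.pow_of_coprime p (((Nat.coprime_primes hp hq).2 hpq).pow_right β))
      (hzero z (hz.ne_zero hqb.ne'))
  -- If the lowered exponent were $0$, then $\Phi_1$ would divide the mask of $A_0$, forcing
  -- $|A_0|=0$.
  have hα1 : 1 ≤ α := by
    by_contra hα0
    obtain rfl : α = 0 := by omega
    rw [pow_zero, cycDvd_iff one_pos IsPrimitiveRoot.one] at h1'
    simp only [rootSum, one_pow, Finset.sum_const, nsmul_eq_mul, mul_one, Nat.cast_eq_zero] at h1'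
    have := h0.card_mul
    rw [h1', zero_mul] at this
    omega
  have h3 := ih hα1 hβ h0 h1' h2'
  obtain ⟨z, hz⟩ := exists_primitiveRoot (Nat.mul_pos (pow_pos hp.pos (α + 1)) hqb)
  have hz' : IsPrimitiveRoot (z ^ p) (p ^ α * q ^ β) :=
    hz.pow (Nat.mul_pos (pow_pos hp.pos _) hqb) (by ring)
  refine h3.of_primitiveRoot (Nat.mul_pos hpa hqb) (Nat.mul_pos (pow_pos hp.pos _) hqb) hz' hz ?_
  intro h4
  rw [rootSum_image_mul_add hp.pos, h4, mul_zero]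

/-- The case of the two-prime theorem in which `B` lies in one class modulo `p`. -/
theorem TilesMod.cycDvd_mul_of_right {p q N c α β : ℕ} (hp : p.Prime) (hq : q.Prime) (hpq : p ≠ q)
    {A B₀ : Finset ℕ} (hN : 0 < N)
    (ih : ∀ {A B : Finset ℕ} {α β : ℕ}, 1 ≤ α → 1 ≤ β → TilesMod N A B → CycDvd A (p ^ α) →
      CycDvd A (q ^ β) → CycDvd A (p ^ α * q ^ β))
    (hα : 1 ≤ α) (hβ : 1 ≤ β) (h : TilesMod (p * N) A (B₀.image (p * · + c)))
    (h1 : CycDvd A (p ^ α)) (h2 : CycDvd A (q ^ β)) :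
    CycDvd A (p ^ α * q ^ β) := by
  have hcl := fun {i} hi => (h.symm.tilesMod_residueClass hp.pos (i := i) hi).symm
  have hpN : 0 < p * N := Nat.mul_pos hp.pos hN
  have hd1 := h.dvd_of_cycDvd hpN hp hα h1
  have hd2 := h.dvd_of_cycDvd hpN hq hβ h2
  obtain ⟨α, rfl⟩ := Nat.exists_eq_add_of_le' hα
  have hpa := pow_pos hp.pos α
  have hqb := pow_pos hq.pos β
  have hcop : p.Coprime (q ^ β) := ((Nat.coprime_primes hp hq).2 hpq).pow_right β
  have hd1' : p ^ α ∣ N := by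
    rw [pow_succ'] at hd1
    exact Nat.dvd_of_mul_dvd_mul_left hp.pos hd1
  have hd2' : q ^ β ∣ N := hcop.symm.dvd_of_dvd_mul_left hd2
  -- If $\Phi_{q^\beta}$ divided the mask of $B_0$, it would also divide that of the dilate of
  -- $B_0$, as $z\mapsto z^p$ preserves order $q^\beta$; but it already divides that of $A$.
  have hclq : ∀ i < p, CycDvd (residueClass p i A) (q ^ β) := by
    intro i hi
    refine ((hcl hi).cycDvd_or hN hd2' (by simp [hq.one_lt.ne', Nat.one_le_iff_ne_zero.1 hβ])).resolve_right
      fun hB => h.not_both hpN hq hβ h2 ?_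
    obtain ⟨z, hz⟩ := exists_primitiveRoot hqb
    refine hB.of_primitiveRoot hqb hqb (hz.pow_of_coprime p hcop) hz fun h4 => ?_
    rw [rootSum_image_mul_add hp.pos, h4, mul_zero]
  have hclpq : ∀ i < p, CycDvd (residueClass p i A) (p ^ α * q ^ β) := by
    intro i hi
    rcases Nat.eq_zero_or_pos α with rfl | hα1
    · simpa using hclq i hi
    refine ih hα1 hβ (hcl hi) ?_ (hclq i hi)
    refine ((hcl hi).cycDvd_or hN hd1' (by simp [hp.one_lt.ne', hα1.ne'])).resolve_right
      fun hB => h.not_both hpN hp hα h1 ?_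
    obtain ⟨z, hz⟩ := exists_primitiveRoot (pow_pos hp.pos (α + 1))
    refine hB.of_primitiveRoot hpa (pow_pos hp.pos _)
      (hz.pow (pow_pos hp.pos _) (by rw [pow_succ'])) hz fun h4 => ?_
    rw [rootSum_image_mul_add hp.pos, h4, mul_zero]
  obtain ⟨z, hz⟩ := exists_primitiveRoot (Nat.mul_pos (pow_pos hp.pos (α + 1)) hqb)
  have hz' : IsPrimitiveRoot (z ^ p) (p ^ α * q ^ β) :=
    hz.pow (Nat.mul_pos (pow_pos hp.pos _) hqb) (by ring)
  rw [cycDvd_iff (Nat.mul_pos (pow_pos hp.pos _) hqb) hz, rootSum_eq_sum_residueClass hp.pos]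
  refine Finset.sum_eq_zero fun i hi => ?_
  rw [(cycDvd_iff (Nat.mul_pos hpa hqb) hz').1 (hclpq i (Finset.mem_range.1 hi)), mul_zero]

/-- The condition (T2) for tilings of a cyclic group whose order has at most two prime factors. -/
theorem TilesMod.cycDvd_mul {p q M : ℕ} (hp : p.Prime) (hq : q.Prime) (hpq : p ≠ q) (hM : 0 < M)
    (hM' : ∀ l : ℕ, l.Prime → l ∣ M → l = p ∨ l = q) {A B : Finset ℕ} {α β : ℕ} (hα : 1 ≤ α)
    (hβ : 1 ≤ β) (h : TilesMod M A B) (h1 : CycDvd A (p ^ α)) (h2 : CycDvd A (q ^ β)) :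
    CycDvd A (p ^ α * q ^ β) := by
  induction M using Nat.strong_induction_on generalizing A B α β with
  | _ M IH =>
  have hpM : p ∣ M := (dvd_pow_self p (by omega)).trans (h.dvd_of_cycDvd hM hp hα h1)
  have hqM : q ∣ M := (dvd_pow_self q (by omega)).trans (h.dvd_of_cycDvd hM hq hβ h2)
  have hih : ∀ {r N : ℕ}, r.Prime → M = r * N → ∀ {A B : Finset ℕ} {α β : ℕ}, 1 ≤ α → 1 ≤ β →
      TilesMod N A B → CycDvd A (p ^ α) → CycDvd A (q ^ β) → CycDvd A (p ^ α * q ^ β) := by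
    intro r N hr hMN A B α β hα hβ h h1 h2
    have hN : 0 < N := Nat.pos_of_ne_zero (by rintro rfl; omega)
    refine IH N ?_ hN (fun l hl hd => hM' l hl (hMN ▸ hd.mul_left r)) hα hβ h h1 h2
    rw [hMN]; exact (Nat.lt_mul_iff_one_lt_left hN).2 hr.one_lt
  have hih' : ∀ {r N : ℕ}, r.Prime → M = r * N → ∀ {A B : Finset ℕ} {β α : ℕ}, 1 ≤ β → 1 ≤ α →
      TilesMod N A B → CycDvd A (q ^ β) → CycDvd A (p ^ α) → CycDvd A (q ^ β * p ^ α) := by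
    intro r N hr hMN A B β α hβ hα h h2 h1
    rw [mul_comm]
    exact hih hr hMN hα hβ h h1 h2
  obtain ⟨N, hN⟩ := hpM
  obtain ⟨N', hN'⟩ := hqM
  have hN0 : 0 < N := Nat.pos_of_ne_zero (by rintro rfl; omega)
  have hN0' : 0 < N' := Nat.pos_of_ne_zero (by rintro rfl; omega)
  rcases h.exists_mod_eq hp ⟨N, hN⟩ hM hM' with ⟨c, hc⟩ | ⟨c, hc⟩ | ⟨c, hc⟩ | ⟨c, hc⟩
  · rw [eq_image_of_mod_eq hc, hN] at h
    rw [eq_image_of_mod_eq hc] at h1 h2 ⊢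
    exact h.cycDvd_mul_of_left hp hq hpq hN0 (hih hp hN) hα hβ h1 h2
  · rw [eq_image_of_mod_eq hc, hN'] at h
    rw [eq_image_of_mod_eq hc] at h1 h2 ⊢
    rw [mul_comm]
    exact h.cycDvd_mul_of_left hq hp hpq.symm hN0' (hih' hq hN') hβ hα h2 h1
  · rw [eq_image_of_mod_eq hc, hN] at h
    exact h.cycDvd_mul_of_right hp hq hpq hN0 (hih hp hN) hα hβ h1 h2
  · rw [eq_image_of_mod_eq hc, hN'] at h
    rw [mul_comm]
    exact h.cycDvd_mul_of_right hq hp hpq.symm hN0' (hih' hq hN') hβ hα h2 h1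

/-- The condition (T2) for a non-empty set of primes contained in `{p, q}`. -/
theorem TilesMod.cycDvd_prod {p q M : ℕ} (hp : p.Prime) (hq : q.Prime) (hpq : p ≠ q) (hM : 0 < M)
    (hM' : ∀ l : ℕ, l.Prime → l ∣ M → l = p ∨ l = q) {A B : Finset ℕ} (h : TilesMod M A B)
    {J : Finset ℕ} {e : ℕ → ℕ} (hJ : J.Nonempty) (hJs : J ⊆ {p, q})
    (he : ∀ l ∈ J, 1 ≤ e l ∧ CycDvd A (l ^ e l)) : CycDvd A (∏ l ∈ J, l ^ e l) := by
  by_cases hpJ : p ∈ J <;> by_cases hqJ : q ∈ J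
  · obtain rfl : J = {p, q} := hJs.antisymm (by intro l; simp; rintro (rfl | rfl) <;> assumption)
    rw [Finset.prod_pair hpq]
    exact h.cycDvd_mul hp hq hpq hM hM' (he p hpJ).1 (he q hqJ).1 (he p hpJ).2 (he q hqJ).2
  · obtain rfl : J = {p} := by
      refine Finset.Subset.antisymm (fun l hl => ?_) (by simpa)
      have := hJs hl
      simp only [Finset.mem_insert, Finset.mem_singleton] at this ⊢
      rcases this with rfl | rfl
      · rfl
      · exact absurd hl hqJ
    rw [Finset.prod_singleton]; exact (he p hpJ).2
  · obtain rfl : J = {q} := by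
      refine Finset.Subset.antisymm (fun l hl => ?_) (by simpa)
      have := hJs hl
      simp only [Finset.mem_insert, Finset.mem_singleton] at this ⊢
      rcases this with rfl | rfl
      · exact absurd hl hpJ
      · rfl
    rw [Finset.prod_singleton]; exact (he q hqJ).2
  · obtain ⟨l, hl⟩ := hJ
    have := hJs hl
    simp only [Finset.mem_insert, Finset.mem_singleton] at this
    rcases this with rfl | rfl <;> contradiction

/-! ### Reduction of the fibered case to two primes -/

theorem rootSum_image_mul {d m : ℕ} (hd : 0 < d) (z : ℂ) :
    rootSum ((Finset.range m).image (· * d)) z = ∑ ν ∈ Finset.range m, (z ^ d) ^ ν := by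
  rw [rootSum, Finset.sum_image fun a _ b _ h => Nat.eq_of_mul_eq_mul_right hd h]
  exact Finset.sum_congr rfl fun ν _ => by rw [← pow_mul, mul_comm]

/-- Let `M = p ^ n * N`, where `p` does not divide `N` and `N` has at most two prime factors `q` and
`r`. If `A` tiles with `B`, and `A` is the direct sum of `A'` and the fiber in the `p` direction,
where `p` does not divide the cardinality of `A'`, then `A` and `B` satisfy (T2). -/
theorem polyT2_of_fibered {p q r n N d M : ℕ} (hp : p.Prime) (hq : q.Prime) (hr : r.Prime)
    (hpq : p ≠ q) (hpr : p ≠ r) (hqr : q ≠ r) (hn : 1 ≤ n) (hN : 0 < N)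
    (hN' : ∀ l : ℕ, l.Prime → l ∣ N → l = q ∨ l = r) (hM : M = p ^ n * N) (hMd : M = p * d)
    {A A' B : Finset ℕ} (hAB : TilesMod M A B)
    (hA'C : TilesMod M A' ((B ×ˢ (Finset.range p).image (· * d)).image fun y => y.1 + y.2))
    (hAz : ∀ z : ℂ, z ^ M = 1 →
      rootSum A z = rootSum A' z * rootSum ((Finset.range p).image (· * d)) z)
    (hcard : p.Coprime A'.card) :
    PolyT2 (natMask A) ∧ PolyT2 (natMask B) := by
  set F := (Finset.range p).image (· * d) with hF
  set C := (B ×ˢ F).image fun y => y.1 + y.2 with hC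
  have hpn : 0 < p ^ n := pow_pos hp.pos n
  have hM0 : 0 < M := hM ▸ Nat.mul_pos hpn hN
  have hd0 : 0 < d := Nat.pos_of_ne_zero (by rintro rfl; omega)
  have hdeq : d = p ^ (n - 1) * N := by
    refine Nat.eq_of_mul_eq_mul_left hp.pos ?_
    rw [← hMd, hM, ← mul_assoc, mul_pow_sub_one (by omega)]
  have hpF : F.card = p := by
    rw [hF, Finset.card_image_of_injective _ (mul_left_injective₀ hd0.ne'), Finset.card_range]
  -- values of the mask polynomial of the fiber
  have hF1 : ∀ z : ℂ, z ^ d = 1 → rootSum F z = p := by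
    intro z hz
    rw [hF, rootSum_image_mul hd0, hz]; simp
  have hF0 : ∀ z : ℂ, z ^ M = 1 → z ^ d ≠ 1 → rootSum F z = 0 := by
    intro z hz hz'
    rw [hF, rootSum_image_mul hd0]
    have h1 := geom_sum_mul (z ^ d) p
    rw [← pow_mul, mul_comm d p, ← hMd, hz, sub_self] at h1
    exact (mul_eq_zero.1 h1).resolve_right (sub_ne_zero.2 hz')
  have hp0 : (p : ℂ) ≠ 0 := by exact_mod_cast hp.ne_zero
  have hdM : d ∣ M := ⟨p, by rw [hMd, mul_comm]⟩
  have hprimes : ∀ l : ℕ, l.Prime → l ∣ M → l = p ∨ l = q ∨ l = r := by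
    intro l hl hlM
    rw [hM] at hlM
    rcases hl.dvd_mul.1 hlM with h | h
    · exact Or.inl ((Nat.prime_dvd_prime_iff_eq hl hp).1 (hl.dvd_of_dvd_pow h))
    · exact Or.inr (hN' l hl h)
  have hpN_of_ne : ∀ l e : ℕ, l.Prime → l ≠ p → l ^ e ∣ M → l ^ e ∣ N := by
    intro l e hl hlp h
    rw [hM] at h
    exact (Nat.Coprime.pow e n ((Nat.coprime_primes hl hp).2 hlp)).dvd_of_dvd_mul_left h
  have hNd : N ∣ d := ⟨p ^ (n - 1), by rw [hdeq, mul_comm]⟩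
  have hA'iff : ∀ s : ℕ, s ∣ d → (CycDvd A s ↔ CycDvd A' s) := by
    intro s hs
    have hs0 := Nat.pos_of_dvd_of_pos hs hd0
    obtain ⟨z, hz⟩ := exists_primitiveRoot hs0
    rw [cycDvd_iff hs0 hz, cycDvd_iff hs0 hz, hAz z ((hz.pow_eq_one_iff_dvd _).2 (hs.trans hdM)),
      hF1 z ((hz.pow_eq_one_iff_dvd _).2 hs)]
    simp [hp0]
  have hCsum : ∀ z : ℂ, rootSum C z = rootSum B z * rootSum F z := by
    intro z
    -- Directness of $B+F$ is read off cardinalities: $|A'||C|=M=|A'|\,p\,|B|$.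
    have hinj : Set.InjOn (fun y : ℕ × ℕ => y.1 + y.2) (B ×ˢ F : Finset (ℕ × ℕ)) := by
      rw [← Finset.card_image_iff, ← hC, Finset.card_product, hpF]
      refine le_antisymm ?_ ?_
      · rw [hC, ← hpF, ← Finset.card_product]; exact Finset.card_image_le
      · have h1 := hA'C.card_mul
        have h2 := hAB.card_mul
        have h3 : A.card = A'.card * p := by
          have := hAz 1 (one_pow _)
          rw [hF1 1 (one_pow _)] at this
          simp only [rootSum, one_pow, Finset.sum_const, nsmul_eq_mul, mul_one] at this
          exact_mod_cast this
        rw [h3, ← h1, mul_assoc] at h2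
        have h4 : 0 < A'.card := Nat.pos_of_ne_zero fun h0 => by rw [h0] at h1; omega
        rw [← Nat.eq_of_mul_eq_mul_left h4 h2, mul_comm]
    rw [rootSum, hC, Finset.sum_image hinj, rootSum, rootSum, Finset.sum_mul_sum,
      ← Finset.sum_product']
    exact Finset.sum_congr rfl fun y _ => pow_add _ _ _
  have hcl : ∀ i < p ^ n, TilesMod N A' (residueClass (p ^ n) i C) := by
    intro i hi
    have h1 := hA'C.dilate hM0 hpn (hcard.pow_left n)
    rw [hM] at h1
    exact TilesMod.tilesMod_residueClass (c := 0) hpn (by simpa using h1) hi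
  have hpN : ¬ p ∣ N := fun h => (hN' p hp h).elim hpq hpr
  have hpnd : ¬ p ^ n ∣ d := by
    intro h
    rw [hdeq, ← pow_sub_one_mul (by omega : n ≠ 0)] at h
    exact hpN (Nat.dvd_of_mul_dvd_mul_left (pow_pos hp.pos _) h)
  have hpow_le : ∀ e, p ^ e ∣ M → e ≤ n := by
    intro e he
    rw [hM] at he
    exact (Nat.pow_dvd_pow_iff_le_right hp.one_lt).1
      ((Nat.Coprime.pow_left e ((Nat.Prime.coprime_iff_not_dvd hp).2 hpN)).dvd_of_dvd_mul_right he)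
  have hA_of : ∀ s : ℕ, s ∣ M → ¬ s ∣ d → CycDvd A s := by
    intro s hs hsd
    have hs0 := Nat.pos_of_dvd_of_pos hs hM0
    obtain ⟨z, hz⟩ := exists_primitiveRoot hs0
    rw [cycDvd_iff hs0 hz, hAz z ((hz.pow_eq_one_iff_dvd _).2 hs),
      hF0 z ((hz.pow_eq_one_iff_dvd _).2 hs) fun h => hsd ((hz.pow_eq_one_iff_dvd _).1 h), mul_zero]
  have hprod : ∀ (J : Finset ℕ) (e : ℕ → ℕ) (m : ℕ), (∀ l ∈ J, l.Prime ∧ l ^ e l ∣ m) →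
      ∏ l ∈ J, l ^ e l ∣ m := by
    intro J e m h
    refine Finset.prod_dvd_of_isRelPrime (fun l hl l' hl' hne => ?_) fun l hl => (h l hl).2
    exact (Nat.coprime_iff_isRelPrime).1
      (Nat.Coprime.pow _ _ ((Nat.coprime_primes (h l hl).1 (h l' hl').1).2 hne))
  have hJsub : ∀ (J : Finset ℕ) (e : ℕ → ℕ), p ∉ J →
      (∀ l ∈ J, l.Prime ∧ 1 ≤ e l ∧ l ^ e l ∣ M) → J ⊆ {q, r} := by
    intro J e hpJ h l hl
    have h1 := hprimes l (h l hl).1 ((dvd_pow_self l (by have := (h l hl).2.1; omega)).trans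
      (h l hl).2.2)
    rcases h1 with rfl | h1
    · exact absurd hl hpJ
    · simpa using h1
  refine ⟨fun J e hJ hJe => ?_, fun J e hJ hJe => ?_⟩
  · have hdvd : ∀ l ∈ J, l ^ e l ∣ M := fun l hl =>
      hAB.dvd_of_cycDvd hM0 (hJe l hl).1 (hJe l hl).2.1 (hJe l hl).2.2
    by_cases hpJ : p ∈ J
    · have hep : e p = n := by
        refine le_antisymm (hpow_le _ (hdvd p hpJ)) ?_
        by_contra! hlt
        have h1 : p ^ e p ∣ d := by
          rw [hdeq]; exact (pow_dvd_pow p (by omega)).mul_right N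
        exact (Nat.Prime.coprime_iff_not_dvd hp).1 hcard
          (((hA'iff _ h1).1 (hJe p hpJ).2.2).prime_dvd_card hp (hJe p hpJ).2.1)
      refine hA_of _ (hprod J e M fun l hl => ⟨(hJe l hl).1, hdvd l hl⟩) fun h => hpnd ?_
      rw [← hep]
      exact (Finset.dvd_prod_of_mem (fun l => l ^ e l) hpJ).trans h
    · have hdN : ∀ l ∈ J, l ^ e l ∣ N := fun l hl =>
        hpN_of_ne l _ (hJe l hl).1 (fun h => hpJ (h ▸ hl)) (hdvd l hl)
      refine (hA'iff _ ((hprod J e N fun l hl => ⟨(hJe l hl).1, hdN l hl⟩).trans hNd)).2 ?_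
      refine (hcl 0 hpn).cycDvd_prod hq hr hqr hN hN' hJ
        (hJsub J e hpJ fun l hl => ⟨(hJe l hl).1, (hJe l hl).2.1, hdvd l hl⟩) fun l hl =>
        ⟨(hJe l hl).2.1, (hA'iff _ ((hdN l hl).trans hNd)).1 (hJe l hl).2.2⟩
  · have hdvd : ∀ l ∈ J, l ^ e l ∣ M := fun l hl =>
      hAB.symm.dvd_of_cycDvd hM0 (hJe l hl).1 (hJe l hl).2.1 (hJe l hl).2.2
    -- The exponent $n$ is excluded for $B$ because the fiber already puts $\Phi_{p^n}$ into the
    -- mask of $A$; $f=0$ covers $p\notin J$.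
    obtain ⟨f, hfn, hfJ⟩ : ∃ f < n, ∏ l ∈ J, l ^ e l = p ^ f * ∏ l ∈ J.erase p, l ^ e l := by
      by_cases hpJ : p ∈ J
      · refine ⟨e p, lt_of_le_of_ne (hpow_le _ (hdvd p hpJ)) fun hep => ?_,
          (Finset.mul_prod_erase J (fun l => l ^ e l) hpJ).symm⟩
        refine hAB.not_both hM0 hp (hJe p hpJ).2.1 ?_ (hJe p hpJ).2.2
        rw [hep]
        exact hA_of _ ⟨N, hM⟩ hpnd
      · exact ⟨0, hn, by rw [pow_zero, one_mul, Finset.erase_eq_of_notMem hpJ]⟩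
    rcases (J.erase p).eq_empty_or_nonempty with hJ' | hJ'
    · have hJp : J = {p} := by
        rcases (Finset.erase_eq_empty_iff _ _).1 hJ' with h | h
        · exact absurd h hJ.ne_empty
        · exact h
      subst hJp
      rw [Finset.prod_singleton]
      exact (hJe p (Finset.mem_singleton_self p)).2.2
    set s := ∏ l ∈ J.erase p, l ^ e l with hs
    have hJl : ∀ l ∈ J.erase p, l ≠ p ∧ l ∈ J := fun l hl => Finset.mem_erase.1 hl
    have hdN : ∀ l ∈ J.erase p, l ^ e l ∣ N := fun l hl =>
      hpN_of_ne l _ (hJe l (hJl l hl).2).1 (hJl l hl).1 (hdvd l (hJl l hl).2)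
    have hsN : s ∣ N := hprod _ e N fun l hl => ⟨(hJe l (hJl l hl).2).1, hdN l hl⟩
    have hs0 := Nat.pos_of_dvd_of_pos hsN hN
    -- A prime-power factor of $B$ at $l\ne p$ is not one of $A$, hence not of $A'$, so every class
    -- of $C$ has it.
    have hCs : ∀ i < p ^ n, CycDvd (residueClass (p ^ n) i C) s := by
      intro i hi
      refine (hcl i hi).symm.cycDvd_prod hq hr hqr hN hN' hJ'
        (hJsub _ e (Finset.notMem_erase p J) fun l hl => ⟨(hJe l (hJl l hl).2).1,
          (hJe l (hJl l hl).2).2.1, hdvd l (hJl l hl).2⟩) fun l hl => ?_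
      obtain ⟨hl1, hl2, hl3⟩ := hJe l (hJl l hl).2
      refine ⟨hl2, ((hcl i hi).cycDvd_or hN (hdN l hl) ?_).resolve_left fun hA' => ?_⟩
      · simp [hl1.one_lt.ne', Nat.one_le_iff_ne_zero.1 hl2]
      · exact hAB.not_both hM0 hl1 hl2 ((hA'iff _ ((hdN l hl).trans hNd)).2 hA') hl3
    have hpf : 0 < p ^ f := pow_pos hp.pos f
    have hpfs : 0 < p ^ f * s := Nat.mul_pos hpf hs0
    have hsd : p ^ f * s ∣ d := by
      rw [hdeq]; exact mul_dvd_mul (pow_dvd_pow p (by omega)) hsN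
    change CycDvd B _
    rw [hfJ]
    obtain ⟨z, hz⟩ := exists_primitiveRoot hpfs
    -- Raising to $p^f$ removes the $p$-part of the order; the remaining power $p^{n-f}$ is coprime
    -- to $s$.
    have hz' : IsPrimitiveRoot (z ^ p ^ n) s := by
      have h1 : IsPrimitiveRoot (z ^ p ^ f) s := hz.pow hpfs rfl
      have h2 : p ^ n = p ^ f * p ^ (n - f) := by rw [← pow_add]; congr 1; omega
      rw [h2, pow_mul]
      refine h1.pow_of_coprime _ (Nat.Coprime.pow_left _ ?_)
      exact (Nat.Prime.coprime_iff_not_dvd hp).2 fun h => hpN (h.trans hsN)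
    have hC0 : rootSum C z = 0 := by
      rw [rootSum_eq_sum_residueClass hpn]
      refine Finset.sum_eq_zero fun i hi => ?_
      rw [(cycDvd_iff hs0 hz').1 (hCs i (Finset.mem_range.1 hi)), mul_zero]
    rw [hCsum, hF1 z ((hz.pow_eq_one_iff_dvd _).2 hsd)] at hC0
    exact (cycDvd_iff hpfs hz).2 ((mul_eq_zero.1 hC0).resolve_right hp0)

/-! ### Transfer from $\mathbb{Z}_M$ to representatives -/

theorem natMask_image_val {M : ℕ} [NeZero M] (A : Finset (ZMod M)) :
    natMask (A.image ZMod.val) = maskPoly A := by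
  rw [natMask, maskPoly, Finset.sum_image fun a _ b _ h => ZMod.val_injective M h]

theorem IsTiling.card_mul {M : ℕ} {A B : Finset (ZMod M)} (h : IsTiling A B) :
    A.card * B.card = M := by
  have h1 := Nat.card_congr (Equiv.ofBijective _ h)
  rw [Nat.card_prod, Nat.card_zmod] at h1
  simpa using h1

theorem IsTiling.exists_add_eq {M : ℕ} {A B : Finset (ZMod M)} (h : IsTiling A B) (x : ZMod M) :
    ∃ a ∈ A, ∃ b ∈ B, a + b = x := by
  obtain ⟨⟨⟨a, ha⟩, ⟨b, hb⟩⟩, hab⟩ := h.2 x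
  exact ⟨a, ha, b, hb, hab⟩

theorem sum_add_of_convWeight {M : ℕ} [NeZero M] {R : Type*} [AddCommMonoid R]
    {A A' F : Finset (ZMod M)} (h : ∀ x, convWeight A' F x = if x ∈ A then 1 else 0)
    (g : ZMod M → R) : ∑ y ∈ A' ×ˢ F, g (y.1 + y.2) = ∑ x ∈ A, g x := by
  have h1 : ∑ x ∈ A, g x = ∑ x, convWeight A' F x • g x := by
    simp [h, ite_smul]
  rw [h1, ← Finset.sum_fiberwise (A' ×ˢ F) fun y => y.1 + y.2]
  refine Finset.sum_congr rfl fun x _ => ?_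
  rw [convWeight, ← Finset.sum_const]
  exact Finset.sum_congr rfl fun y hy => by rw [(Finset.mem_filter.1 hy).2]

theorem fiber_image_val {M p d : ℕ} [NeZero M] (hp : 0 < p) (hM : M = p * d) :
    (fiber M p).image ZMod.val = (Finset.range p).image (· * d) := by
  have hd : M / p = d := by rw [hM, Nat.mul_div_cancel_left _ hp]
  have hd0 : 0 < d := Nat.pos_of_ne_zero (by rintro rfl; exact NeZero.ne M (by simpa using hM))
  rw [fiber, Finset.image_image, hd]
  refine Finset.image_congr fun ν hν => ?_
  have : ν * d < M := hM ▸ Nat.mul_lt_mul_of_pos_right (by simpa using hν) hd0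
  exact ZMod.val_cast_of_lt this

theorem satisfiesT2_of_fibered {p q r n N M : ℕ} (hp : p.Prime) (hq : q.Prime) (hr : r.Prime)
    (hpq : p ≠ q) (hpr : p ≠ r) (hqr : q ≠ r) (hn : 1 ≤ n) (hN : 0 < N)
    (hN' : ∀ l : ℕ, l.Prime → l ∣ N → l = q ∨ l = r) (hM : M = p ^ n * N)
    {A B : Finset (ZMod M)} (hAB : IsTiling A B) {m : ℕ} (hA : A.card = p * m) (hm : p.Coprime m)
    (hfib : IsFibered A p) : SatisfiesT2 A ∧ SatisfiesT2 B := by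
  obtain ⟨A', -, hA'⟩ := hfib
  have hM0 : 0 < M := hM ▸ Nat.mul_pos (pow_pos hp.pos n) hN
  have : NeZero M := ⟨hM0.ne'⟩
  have hMd : M = p * (p ^ (n - 1) * N) := by
    rw [hM, ← mul_assoc, mul_pow_sub_one (by omega)]
  set d := p ^ (n - 1) * N
  have hd0 : 0 < d := Nat.mul_pos (pow_pos hp.pos _) hN
  have hcardv : ∀ S : Finset (ZMod M), (S.image ZMod.val).card = S.card := fun S =>
    Finset.card_image_of_injective _ (ZMod.val_injective M)
  have hFval := fiber_image_val (M := M) hp.pos hMd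
  have hFcard : (fiber M p).card = p := by
    rw [← hcardv, hFval, Finset.card_image_of_injective _ (mul_left_injective₀ hd0.ne'),
      Finset.card_range]
  have hAA' : A.card = A'.card * p := by
    have h1 := sum_add_of_convWeight hA' fun _ => (1 : ℕ)
    simp only [Finset.sum_const, smul_eq_mul, mul_one, Finset.card_product, hFcard] at h1
    exact h1.symm
  have hA'm : A'.card = m := Nat.eq_of_mul_eq_mul_right hp.pos (by rw [← hAA', hA, mul_comm])
  have hmod : ∀ x y : ZMod M, x.val + y.val ≡ (x + y).val [MOD M] := fun x y => by
    rw [ZMod.val_add]; exact (Nat.mod_modEq _ _).symm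
  have hcov : ∀ x : ℕ, ∃ a ∈ A, ∃ b ∈ B, a.val + b.val ≡ x [MOD M] := by
    intro x
    obtain ⟨a, ha, b, hb, hab⟩ := hAB.exists_add_eq (x : ZMod M)
    refine ⟨a, ha, b, hb, (hmod a b).trans ?_⟩
    rw [hab, ZMod.val_natCast]; exact Nat.mod_modEq _ _
  have h1 : TilesMod M (A.image ZMod.val) (B.image ZMod.val) := by
    refine ⟨by rw [hcardv, hcardv, hAB.card_mul], fun x => ?_⟩
    obtain ⟨a, ha, b, hb, hab⟩ := hcov x
    exact ⟨_, Finset.mem_image_of_mem _ ha, _, Finset.mem_image_of_mem _ hb, hab⟩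
  have h2 : TilesMod M (A'.image ZMod.val)
      ((B.image ZMod.val ×ˢ (Finset.range p).image (· * d)).image fun y => y.1 + y.2) := by
    constructor
    · rw [hcardv]
      refine (Nat.mul_le_mul_left _ Finset.card_image_le).trans (le_of_eq ?_)
      rw [Finset.card_product, hcardv, ← hFval, hcardv, hFcard, mul_comm B.card, ← mul_assoc,
        ← hAA', hAB.card_mul]
    · intro x
      obtain ⟨a, ha, b, hb, hab⟩ := hcov x
      -- Positive weight gives $a=a'+f$; the fiber element $f$ then moves over to the side of $B$.
      have hpos : 0 < convWeight A' (fiber M p) a := by rw [hA', if_pos ha]; exact one_pos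
      obtain ⟨⟨a', f⟩, hy⟩ := Finset.card_pos.1 hpos
      obtain ⟨hy, hyx⟩ := Finset.mem_filter.1 hy
      obtain ⟨ha', hf⟩ := Finset.mem_product.1 hy
      refine ⟨_, Finset.mem_image_of_mem _ ha', b.val + f.val, Finset.mem_image.2
        ⟨(b.val, f.val), Finset.mem_product.2 ⟨Finset.mem_image_of_mem _ hb, ?_⟩, rfl⟩, ?_⟩
      · rw [← hFval]; exact Finset.mem_image_of_mem _ hf
      · have h3 := hmod a' f
        rw [show a' + f = a from hyx] at h3
        have h4 := (h3.add_right b.val).trans hab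
        convert h4 using 1; ring
  have hval : ∀ (S : Finset (ZMod M)) (z : ℂ),
      rootSum (S.image ZMod.val) z = ∑ x ∈ S, z ^ x.val := fun S z => by
    rw [rootSum, Finset.sum_image fun a _ b _ h => ZMod.val_injective M h]
  have h3 := polyT2_of_fibered hp hq hr hpq hpr hqr hn hN hN' hM hMd h1 h2 (fun z hz => by
    rw [← hFval, hval, hval, hval, ← sum_add_of_convWeight hA', Finset.sum_mul_sum,
      ← Finset.sum_product']
    refine Finset.sum_congr rfl fun y _ => ?_
    rw [← pow_add, ZMod.val_add, ← pow_eq_pow_mod _ hz]) (by rwa [hcardv, hA'm])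
  rwa [natMask_image_val, natMask_image_val] at h3

theorem mainTheorem7 (p n : Fin 3 → ℕ) (hp : ∀ l, (p l).Prime) (hp_inj : Function.Injective p)
    (hn : ∀ l, 1 ≤ n l) (M : ℕ) (hM : M = ∏ l, p l ^ n l)
    (A B : Finset (ZMod M)) (hAB : IsTiling A B)
    (i j k : Fin 3) (hij : i ≠ j) (hik : i ≠ k) (hjk : j ≠ k)
    (αj αk : ℕ) (hαj : αj ≤ n j) (hαk : αk ≤ n k)
    (hA : A.card = p i * p j ^ αj * p k ^ αk)
    (hfib : IsFibered A (p i)) :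
    SatisfiesT2 A ∧ SatisfiesT2 B := by
  have huniv : ∀ i j k : Fin 3, i ≠ j → i ≠ k → j ≠ k →
      (Finset.univ : Finset (Fin 3)) = {i, j, k} := by decide
  have hM' : M = p i ^ n i * (p j ^ n j * p k ^ n k) := by
    rw [hM, huniv i j k hij hik hjk, Finset.prod_insert (by simp [hij, hik]),
      Finset.prod_pair hjk]
  have hcop : ∀ {l l' : Fin 3} (a : ℕ), l ≠ l' → (p l).Coprime (p l' ^ a) := fun a h =>
    ((Nat.coprime_primes (hp _) (hp _)).2 (hp_inj.ne h)).pow_right a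
  refine satisfiesT2_of_fibered (hp i) (hp j) (hp k) (hp_inj.ne hij) (hp_inj.ne hik)
    (hp_inj.ne hjk) (hn i) (Nat.mul_pos (pow_pos (hp j).pos _) (pow_pos (hp k).pos _)) ?_ hM' hAB
    (hA.trans (mul_assoc _ _ _)) ((hcop αj hij).mul_right (hcop αk hik)) hfib
  intro l hl hd
  rcases hl.dvd_mul.1 hd with h | h
  · exact Or.inl ((Nat.prime_dvd_prime_iff_eq hl (hp j)).1 (hl.dvd_of_dvd_pow h))
  · exact Or.inr ((Nat.prime_dvd_prime_iff_eq hl (hp k)).1 (hl.dvd_of_dvd_pow h))
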